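/- Let $d\ge 2$. For a Borel set $S\subset\mathbb{R}^d$ let $|S|$ be its Lebesgue measure and let $$P(S)=\sup\Big\{\int_S \operatorname{div}\varphi\,dx:\ \varphi\in C^1_c(\mathbb{R}^d;\mathbb{R}^d),\ |\varphi|\le 1\Big\}\in[0,\infty]$$ be its perimeter. For an open connected set $\Omega\subset\mathbb{R}^d$ let $$h(\Omega)=\inf\Big\{\frac{P(S)}{|S|}:\ S\subset\Omega \text{ bounded Borel},\ |S|>0\Big\}$$ be its Cheeger constant; a set $S$ that attains the infimum is called a Cheeger set of $\Omega$. Theorem. For all radii $0<r<R$, the spherical shell $A_{r,R}=\{x\in\mathbb{R}^d:\ r<|x|<R\}$ is a minimal Cheeger set, that is, $A_{r,R}$ is a Cheeger set of itself and every Cheeger set of $A_{r,R}$ coincides with $A_{r,R}$ up to a set of Lebesgue measure zero. Moreover, $$h(A_{r,R})=d\,\frac{R^{d-1}+r^{d-1}}{R^d-r^d}.$$ -/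

import Mathlib

open MeasureTheory
open scoped ENNReal

noncomputable section

/-- The divergence of a vector field `φ` on `ℝ^d`, i.e. `∑ i, ∂φ_i/∂x_i`. -/
def divergence {d : ℕ} (φ : EuclideanSpace ℝ (Fin d) → EuclideanSpace ℝ (Fin d))
    (x : EuclideanSpace ℝ (Fin d)) : ℝ :=
  ∑ i : Fin d, (fderiv ℝ φ x (EuclideanSpace.single i 1)) i

/-- The (variational, De Giorgi) perimeter of a set `S ⊆ ℝ^d`: the supremum of `∫_S div φ` over all
compactly supported `C¹` vector fields `φ` on `ℝ^d` with `|φ| ≤ 1` everywhere. (The field `φ = 0` is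
admissible, so truncating negative integrals at `0` does not change the supremum.) -/
def perimeter {d : ℕ} (S : Set (EuclideanSpace ℝ (Fin d))) : ℝ≥0∞ :=
  ⨆ (φ : EuclideanSpace ℝ (Fin d) → EuclideanSpace ℝ (Fin d)) (_ : ContDiff ℝ 1 φ)
    (_ : HasCompactSupport φ) (_ : ∀ x, ‖φ x‖ ≤ 1),
    ENNReal.ofReal (∫ x in S, divergence φ x)

/-- The competitors in the Cheeger problem for `Ω`: the bounded Borel subsets of `Ω` for which the
quotient perimeter/volume makes sense, that is, those of positive Lebesgue measure. -/
structure IsCheegerCompetitor {d : ℕ} (Ω S : Set (EuclideanSpace ℝ (Fin d))) : Prop where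
  subset : S ⊆ Ω
  measurableSet : MeasurableSet S
  isBounded : Bornology.IsBounded S
  volume_pos : 0 < volume S

/-- The Cheeger constant `h(Ω)`: the infimum of perimeter/volume over all competitors. -/
def cheegerConstant {d : ℕ} (Ω : Set (EuclideanSpace ℝ (Fin d))) : ℝ≥0∞ :=
  ⨅ (S : Set (EuclideanSpace ℝ (Fin d))) (_ : IsCheegerCompetitor Ω S), perimeter S / volume S

/-- `S` is a Cheeger set of `Ω`: a minimiser of perimeter/volume among all competitors. -/
def IsCheegerSet {d : ℕ} (Ω S : Set (EuclideanSpace ℝ (Fin d))) : Prop :=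
  IsCheegerCompetitor Ω S ∧ perimeter S / volume S = cheegerConstant Ω

/-- `Ω` is a minimal Cheeger set: it is a Cheeger set of itself, and the only one. As perimeter and
volume do not see Lebesgue null sets, uniqueness is understood up to null sets. -/
def IsMinimalCheegerSet {d : ℕ} (Ω : Set (EuclideanSpace ℝ (Fin d))) : Prop :=
  IsCheegerSet Ω Ω ∧ ∀ S : Set (EuclideanSpace ℝ (Fin d)), IsCheegerSet Ω S → S =ᵐ[volume] Ω

/-- The open spherical shell `{x ∈ ℝ^d : r < |x| < R}`. -/
def sphericalShell (d : ℕ) (r R : ℝ) : Set (EuclideanSpace ℝ (Fin d)) :=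
  {x | r < ‖x‖ ∧ ‖x‖ < R}

end

/-! The proof is by calibration. The field `w x = (α + c |x|⁻ᵈ) x` has constant divergence `d α` off
the origin. The constants `α`, `c` are fixed by asking that `w` be the outer unit normal of the
shell on both boundary spheres; its radial component then increases strictly from `-1` to `1`, so
`|w| < 1` inside. Testing the perimeter with `w` gives `P(S) ≥ d α |S|` for all `S` in the shell
(`exists_calibration_le_perimeter`). The shell attains equality, because a field of length at most
`1` has flux at most the sphere's area through each boundary sphere (`integral_ball_divergence_le`).

For uniqueness, `|w| < 1` inside leaves room for `w + t ψ` with `ψ` any test field compactly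
supported in the shell and `t > 0` small. On a Cheeger set `S` the bound is already tight, so `∫_S
div ψ ≤ 0`; with `-ψ` this becomes an equality. The indicator of `S` thus has zero distributional
gradient in the shell, which is connected as `d ≥ 2`, and `S` fills it
(`ae_eq_of_integral_divergence_eq_zero`). -/

/-! ### Divergence and integration by parts -/

theorem divergence_smul {d : ℕ} {η : EuclideanSpace ℝ (Fin d) → ℝ}
    {φ : EuclideanSpace ℝ (Fin d) → EuclideanSpace ℝ (Fin d)} {x : EuclideanSpace ℝ (Fin d)}
    (hη : DifferentiableAt ℝ η x) (hφ : DifferentiableAt ℝ φ x) :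
    divergence (fun y => η y • φ y) x = η x * divergence φ x + fderiv ℝ η x (φ x) := by
  have hsum : φ x = ∑ i, φ x i • EuclideanSpace.single i (1 : ℝ) := by
    simpa using ((EuclideanSpace.basisFun (Fin d) ℝ).sum_repr (φ x)).symm
  have h2 : fderiv ℝ η x (φ x) = ∑ i, φ x i * fderiv ℝ η x (EuclideanSpace.single i 1) := by
    conv_lhs => rw [hsum]
    simp
  simp only [divergence, h2, fderiv_fun_smul hη hφ, Finset.mul_sum, ← Finset.sum_add_distrib]
  refine Finset.sum_congr rfl fun i _ => ?_
  simp [mul_comm]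

theorem divergence_add {d : ℕ} {φ ψ : EuclideanSpace ℝ (Fin d) → EuclideanSpace ℝ (Fin d)}
    {x : EuclideanSpace ℝ (Fin d)} (hφ : DifferentiableAt ℝ φ x) (hψ : DifferentiableAt ℝ ψ x) :
    divergence (fun y => φ y + ψ y) x = divergence φ x + divergence ψ x := by
  simp [divergence, fderiv_fun_add hφ hψ, Finset.sum_add_distrib]

theorem divergence_const_smul {d : ℕ} (a : ℝ)
    {φ : EuclideanSpace ℝ (Fin d) → EuclideanSpace ℝ (Fin d)}
    {x : EuclideanSpace ℝ (Fin d)} (hφ : DifferentiableAt ℝ φ x) :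
    divergence (fun y => a • φ y) x = a * divergence φ x := by
  simp [divergence, fderiv_fun_const_smul hφ, Finset.mul_sum]

theorem divergence_neg {d : ℕ} (φ : EuclideanSpace ℝ (Fin d) → EuclideanSpace ℝ (Fin d))
    (x : EuclideanSpace ℝ (Fin d)) : divergence (fun y => -φ y) x = -divergence φ x := by
  simp [divergence, fderiv_fun_neg]

theorem Filter.EventuallyEq.divergence_eq {d : ℕ}
    {φ ψ : EuclideanSpace ℝ (Fin d) → EuclideanSpace ℝ (Fin d)}
    {x : EuclideanSpace ℝ (Fin d)} (h : φ =ᶠ[nhds x] ψ) : divergence φ x = divergence ψ x := by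
  simp [divergence, h.fderiv_eq]

theorem ContDiff.continuous_divergence {d : ℕ}
    {φ : EuclideanSpace ℝ (Fin d) → EuclideanSpace ℝ (Fin d)} (hφ : ContDiff ℝ 1 φ) :
    Continuous (divergence φ) := by
  have := hφ.continuous_fderiv one_ne_zero
  unfold divergence
  fun_prop

theorem HasCompactSupport.divergence {d : ℕ}
    {φ : EuclideanSpace ℝ (Fin d) → EuclideanSpace ℝ (Fin d)} (hφ : HasCompactSupport φ) :
    HasCompactSupport (divergence φ) := by
  refine (hφ.fderiv (𝕜 := ℝ)).mono fun x hx => ?_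
  contrapose! hx
  simp only [Function.mem_support, not_not] at hx ⊢
  simp [_root_.divergence, hx]

theorem integrable_divergence {d : ℕ}
    {φ : EuclideanSpace ℝ (Fin d) → EuclideanSpace ℝ (Fin d)} (hφ : ContDiff ℝ 1 φ)
    (hc : HasCompactSupport φ) : Integrable (divergence φ) :=
  hφ.continuous_divergence.integrable_of_hasCompactSupport hc.divergence

theorem integral_divergence_eq_zero {d : ℕ}
    {φ : EuclideanSpace ℝ (Fin d) → EuclideanSpace ℝ (Fin d)} (hφ : ContDiff ℝ 1 φ)
    (hc : HasCompactSupport φ) : ∫ x, divergence φ x = 0 := by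
  have hcont := hφ.continuous_fderiv one_ne_zero
  have key (v : EuclideanSpace ℝ (Fin d)) : Integrable fun x => fderiv ℝ φ x v :=
    (by fun_prop : Continuous fun x => fderiv ℝ φ x v).integrable_of_hasCompactSupport
      (hc.fderiv_apply ℝ v)
  have hint (v : EuclideanSpace ℝ (Fin d)) : ∫ x, fderiv ℝ φ x v = 0 := by
    -- Integration by parts against the constant function `1`.
    have := integral_smul_fderiv_eq_neg_fderiv_smul_of_integrable (μ := volume)
      (f := fun _ : EuclideanSpace ℝ (Fin d) => (1 : ℝ)) (g := φ) (v := v)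
      (by simp) (by simpa using key v)
      (by simpa using hφ.continuous.integrable_of_hasCompactSupport hc)
      (by simp) (fun x _ => hφ.differentiable one_ne_zero x)
    simpa using this
  unfold divergence
  have hcomp (i : Fin d) : ∀ y : EuclideanSpace ℝ (Fin d), y i = EuclideanSpace.proj (𝕜 := ℝ) i y :=
    fun _ => rfl
  rw [integral_finsetSum]
  · refine Finset.sum_eq_zero fun i _ => ?_
    simp_rw [hcomp i]
    rw [ContinuousLinearMap.integral_comp_comm _ (key _), hint, map_zero]
  · intro i _
    exact (EuclideanSpace.proj (𝕜 := ℝ) i).integrable_comp (key _)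

theorem integral_mul_divergence {d : ℕ} {η : EuclideanSpace ℝ (Fin d) → ℝ}
    {φ : EuclideanSpace ℝ (Fin d) → EuclideanSpace ℝ (Fin d)} (hη : ContDiff ℝ 1 η)
    (hφ : ContDiff ℝ 1 φ) (hc : HasCompactSupport φ) :
    ∫ x, η x * divergence φ x = -∫ x, fderiv ℝ η x (φ x) := by
  have h := integral_divergence_eq_zero (hη.smul hφ) (hc.smul_left (f := η))
  have heq : divergence (η • φ) = fun x => η x * divergence φ x + fderiv ℝ η x (φ x) :=
    funext fun x => divergence_smul (hη.differentiable one_ne_zero x)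
      (hφ.differentiable one_ne_zero x)
  have hη' := hη.continuous_fderiv one_ne_zero
  have hφ0 := hφ.continuous
  change ∫ x, divergence (η • φ) x = 0 at h
  rw [heq, integral_add] at h
  · linarith
  · exact (hη.continuous.mul hφ.continuous_divergence).integrable_of_hasCompactSupport
      hc.divergence.mul_left
  · refine (by fun_prop : Continuous fun x => fderiv ℝ η x (φ x)).integrable_of_hasCompactSupport
      (hc.mono fun x hx => ?_)
    contrapose! hx
    simp only [Function.mem_support, not_not] at hx ⊢
    simp [hx]

/-! ### Flux through a sphere, by smooth cutoffs of the ball -/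

/-- A smooth function equal to `1` deep inside the ball of radius `ρ` and to `0` outside of it. -/
noncomputable def ballCutoff {E : Type*} [Norm E] (ρ k : ℝ) (x : E) : ℝ :=
  Real.smoothTransition (k * (ρ ^ 2 - ‖x‖ ^ 2))

/-- The size of the gradient of `ballCutoff ρ k` at distance `y` from the centre. -/
noncomputable def ballCutoffSlope (ρ k y : ℝ) : ℝ :=
  deriv Real.smoothTransition (k * (ρ ^ 2 - y ^ 2)) * (2 * k * y)

theorem continuous_deriv_smoothTransition : Continuous (deriv Real.smoothTransition) :=
  (Real.smoothTransition.contDiff (n := 1)).continuous_deriv le_rfl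

theorem continuous_ballCutoffSlope (ρ k : ℝ) : Continuous (ballCutoffSlope ρ k) := by
  have := continuous_deriv_smoothTransition
  unfold ballCutoffSlope
  fun_prop

/-- Every such point is a global minimum. -/
theorem deriv_smoothTransition_eq_zero {x : ℝ} (hx : x ≤ 0) :
    deriv Real.smoothTransition x = 0 := by
  refine IsLocalMin.deriv_eq_zero (Filter.Eventually.of_forall fun y => ?_)
  rw [Real.smoothTransition.zero_of_nonpos hx]
  exact Real.smoothTransition.nonneg y

theorem ballCutoffSlope_eq_zero {ρ k y : ℝ} (hρ : 0 ≤ ρ) (hk : 0 ≤ k) (hy : ρ ≤ y) :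
    ballCutoffSlope ρ k y = 0 := by
  rw [ballCutoffSlope, deriv_smoothTransition_eq_zero, zero_mul]
  exact mul_nonpos_of_nonneg_of_nonpos hk (by nlinarith)

theorem hasDerivAt_smoothTransition_slope (ρ k y : ℝ) :
    HasDerivAt (fun y => -Real.smoothTransition (k * (ρ ^ 2 - y ^ 2)))
      (ballCutoffSlope ρ k y) y := by
  have h1 := ((Real.smoothTransition.contDiff (n := 1)).differentiable one_ne_zero
    (k * (ρ ^ 2 - y ^ 2))).hasDerivAt
  have h2 : HasDerivAt (fun y : ℝ => k * (ρ ^ 2 - y ^ 2)) (k * (-(2 * y))) y := by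
    simpa using ((hasDerivAt_pow 2 y).const_sub (ρ ^ 2)).const_mul k
  refine (h1.comp y h2).neg.congr_deriv ?_
  simp only [ballCutoffSlope]
  ring

/-- The slope is minus the derivative of a cutoff decreasing from at most `1` to `0`, so its mass is
at most `1`, and it sits where `y ^ m ≤ ρ ^ m`. -/
theorem integral_pow_mul_ballCutoffSlope_le {ρ k : ℝ} (hρ : 0 ≤ ρ) (hk : 0 ≤ k) (m : ℕ) :
    ∫ y in Set.Ioi (0 : ℝ), y ^ m * ballCutoffSlope ρ k y ≤ ρ ^ m := by
  have hcont := continuous_ballCutoffSlope ρ k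
  have h1 : ∫ y in Set.Ioi (0 : ℝ), y ^ m * ballCutoffSlope ρ k y =
      ∫ y in Set.Ioc (0 : ℝ) ρ, y ^ m * ballCutoffSlope ρ k y := by
    refine setIntegral_eq_of_subset_of_forall_sdiff_eq_zero measurableSet_Ioi
      Set.Ioc_subset_Ioi_self fun y hy => ?_
    have : ρ ≤ y := by
      by_contra! h
      exact hy.2 ⟨hy.1, h.le⟩
    rw [ballCutoffSlope_eq_zero hρ hk this, mul_zero]
  rw [h1, ← intervalIntegral.integral_of_le hρ]
  calc ∫ y in (0 : ℝ)..ρ, y ^ m * ballCutoffSlope ρ k y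
      ≤ ∫ y in (0 : ℝ)..ρ, ρ ^ m * ballCutoffSlope ρ k y := by
        refine intervalIntegral.integral_mono_on hρ
          ((by fun_prop : Continuous _).intervalIntegrable _ _)
          ((by fun_prop : Continuous _).intervalIntegrable _ _) fun y hy => ?_
        have : 0 ≤ ballCutoffSlope ρ k y :=
          mul_nonneg (Real.smoothTransition.monotone.deriv_nonneg)
            (mul_nonneg (by positivity) hy.1)
        gcongr
        exacts [hy.1, hy.2]
    _ = ρ ^ m * (-Real.smoothTransition 0 + Real.smoothTransition (k * ρ ^ 2)) := by
        rw [intervalIntegral.integral_const_mul, intervalIntegral.integral_eq_sub_of_hasDerivAt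
          (fun y _ => hasDerivAt_smoothTransition_slope ρ k y) (hcont.intervalIntegrable _ _)]
        simp
    _ ≤ ρ ^ m * 1 := by
        gcongr
        rw [Real.smoothTransition.zero]
        linarith [Real.smoothTransition.le_one (k * ρ ^ 2)]
    _ = ρ ^ m := mul_one _

theorem contDiff_ballCutoff {d : ℕ} (ρ k : ℝ) :
    ContDiff ℝ 1 (ballCutoff ρ k : EuclideanSpace ℝ (Fin d) → ℝ) := by
  unfold ballCutoff
  exact Real.smoothTransition.contDiff.comp (contDiff_const.mul
    (contDiff_const.sub (contDiff_norm_sq ℝ)))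

theorem neg_fderiv_ballCutoff_apply_le {d : ℕ} {ρ k : ℝ} (hk : 0 ≤ k)
    (x v : EuclideanSpace ℝ (Fin d)) (hv : ‖v‖ ≤ 1) :
    -fderiv ℝ (ballCutoff ρ k) x v ≤ ballCutoffSlope ρ k ‖x‖ := by
  have h1 := ((Real.smoothTransition.contDiff (n := 1)).differentiable one_ne_zero
    (k * (ρ ^ 2 - ‖x‖ ^ 2))).hasDerivAt
  have h2 : HasFDerivAt (fun y : EuclideanSpace ℝ (Fin d) => k * (ρ ^ 2 - ‖y‖ ^ 2))
      (k • -((2 : ℕ) • (innerSL ℝ x : EuclideanSpace ℝ (Fin d) →L[ℝ] ℝ))) x :=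
    ((hasStrictFDerivAt_norm_sq x).hasFDerivAt.const_sub (ρ ^ 2)).const_mul k
  have h3 : fderiv ℝ (ballCutoff ρ k) x = _ := (h1.comp_hasFDerivAt x h2).fderiv
  rw [h3]
  have h4 : inner ℝ x v ≤ ‖x‖ :=
    (real_inner_le_norm x v).trans (mul_le_of_le_one_right (norm_nonneg _) hv)
  have h5 : 0 ≤ deriv Real.smoothTransition (k * (ρ ^ 2 - ‖x‖ ^ 2)) :=
    Real.smoothTransition.monotone.deriv_nonneg
  simp only [smul_apply, neg_apply, innerSL_apply_apply,
    smul_eq_mul, ballCutoffSlope, nsmul_eq_mul]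
  have : deriv Real.smoothTransition (k * (ρ ^ 2 - ‖x‖ ^ 2)) * (2 * k * inner ℝ x v) ≤
      deriv Real.smoothTransition (k * (ρ ^ 2 - ‖x‖ ^ 2)) * (2 * k * ‖x‖) := by gcongr
  push_cast
  linarith

/-- Integration by parts moves the derivative to the cutoff, whose gradient is radial; polar
coordinates leave a one-dimensional integral. -/
theorem integral_ballCutoff_mul_divergence_le {d : ℕ} {ρ k : ℝ} (hρ : 0 ≤ ρ) (hk : 0 ≤ k)
    {φ : EuclideanSpace ℝ (Fin d) → EuclideanSpace ℝ (Fin d)} (hφ : ContDiff ℝ 1 φ)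
    (hc : HasCompactSupport φ) (h1 : ∀ x, ‖φ x‖ ≤ 1) [NeZero d] :
    ∫ x, ballCutoff ρ k x * divergence φ x ≤
      d * volume.real (Metric.ball (0 : EuclideanSpace ℝ (Fin d)) 1) * ρ ^ (d - 1) := by
  have hη' := (contDiff_ballCutoff (d := d) ρ k).continuous_fderiv one_ne_zero
  have hφ0 := hφ.continuous
  rw [integral_mul_divergence (contDiff_ballCutoff ρ k) hφ hc, ← integral_neg]
  calc ∫ x, -fderiv ℝ (ballCutoff ρ k) x (φ x)
      ≤ ∫ x : EuclideanSpace ℝ (Fin d), ballCutoffSlope ρ k ‖x‖ := by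
        refine integral_mono ?_ ?_ fun x => neg_fderiv_ballCutoff_apply_le hk x _ (h1 x)
        · refine (by fun_prop : Continuous fun x => -fderiv ℝ (ballCutoff ρ k) x
            (φ x)).integrable_of_hasCompactSupport (hc.mono fun x hx => ?_)
          contrapose! hx
          simp only [Function.mem_support, not_not] at hx ⊢
          simp [hx]
        · refine ((continuous_ballCutoffSlope ρ k).comp
            continuous_norm).integrable_of_hasCompactSupport
            (HasCompactSupport.intro (isCompact_closedBall 0 ρ) fun x hx => ?_)
          rw [mem_closedBall_zero_iff, not_le] at hx
          exact ballCutoffSlope_eq_zero hρ hk hx.le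
    _ = d * volume.real (Metric.ball (0 : EuclideanSpace ℝ (Fin d)) 1) *
          ∫ y in Set.Ioi (0 : ℝ), y ^ (d - 1) * ballCutoffSlope ρ k y := by
        rw [integral_fun_norm_addHaar volume (ballCutoffSlope ρ k)]
        simp [mul_assoc]
    _ ≤ _ := by
        gcongr
        exact integral_pow_mul_ballCutoffSlope_le hρ hk _

/-- Stands in for the divergence theorem on a ball, without surface measure: as `k → ∞` the cutoffs
tend pointwise to the indicator of the open ball, dominated by `|div φ|`. -/
theorem integral_ball_divergence_le {d : ℕ} [NeZero d] {ρ : ℝ} (hρ : 0 ≤ ρ)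
    {φ : EuclideanSpace ℝ (Fin d) → EuclideanSpace ℝ (Fin d)} (hφ : ContDiff ℝ 1 φ)
    (hc : HasCompactSupport φ) (h1 : ∀ x, ‖φ x‖ ≤ 1) :
    ∫ x in Metric.ball 0 ρ, divergence φ x ≤
      d * volume.real (Metric.ball (0 : EuclideanSpace ℝ (Fin d)) 1) * ρ ^ (d - 1) := by
  have hlim : Filter.Tendsto (fun n : ℕ => ∫ x, ballCutoff ρ (n : ℝ) x * divergence φ x)
      Filter.atTop (nhds (∫ x, (Metric.ball 0 ρ).indicator (divergence φ) x)) := by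
    refine tendsto_integral_of_dominated_convergence (fun x => ‖divergence φ x‖) (fun n => ?_)
      (integrable_divergence hφ hc).norm (fun n => Filter.Eventually.of_forall fun x => ?_)
      (Filter.Eventually.of_forall fun x => ?_)
    · exact ((contDiff_ballCutoff ρ n).continuous.mul
        hφ.continuous_divergence).aestronglyMeasurable
    · rw [norm_mul, ballCutoff, Real.norm_of_nonneg (Real.smoothTransition.nonneg _)]
      exact mul_le_of_le_one_left (norm_nonneg _) (Real.smoothTransition.le_one _)
    · refine tendsto_const_nhds.congr' ?_
      by_cases hx : x ∈ Metric.ball 0 ρ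
      · rw [Set.indicator_of_mem hx]
        have hpos : 0 < ρ ^ 2 - ‖x‖ ^ 2 := by
          rw [mem_ball_zero_iff] at hx
          nlinarith [norm_nonneg x]
        have ht := tendsto_natCast_atTop_atTop.atTop_mul_const hpos
        filter_upwards [ht.eventually_ge_atTop 1] with n hn
        rw [ballCutoff, Real.smoothTransition.one_of_one_le hn, one_mul]
      · rw [Set.indicator_of_notMem hx]
        refine Filter.Eventually.of_forall fun n => ?_
        rw [mem_ball_zero_iff, not_lt] at hx
        dsimp only
        rw [ballCutoff, Real.smoothTransition.zero_of_nonpos, zero_mul]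
        exact mul_nonpos_of_nonneg_of_nonpos (Nat.cast_nonneg n) (by nlinarith)
  rw [integral_indicator Metric.isOpen_ball.measurableSet] at hlim
  exact le_of_tendsto' hlim fun n =>
    integral_ballCutoff_mul_divergence_le hρ n.cast_nonneg hφ hc h1

/-! ### Calibration bounds the perimeter from below -/

theorem exists_contDiff_cutoff {d : ℕ} {K U : Set (EuclideanSpace ℝ (Fin d))} (hK : IsClosed K)
    (hU : IsOpen U) (hb : Bornology.IsBounded U) (hKU : K ⊆ U) :
    ∃ χ : EuclideanSpace ℝ (Fin d) → ℝ, ContDiff ℝ 1 χ ∧ HasCompactSupport χ ∧ tsupport χ ⊆ U ∧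
      (∀ x ∈ K, ∀ᶠ y in nhds x, χ y = 1) ∧ ∀ x, 0 ≤ χ x ∧ χ x ≤ 1 := by
  obtain ⟨f, h0, h1, hf⟩ := exists_contMDiffMap_zero_one_nhds_of_isClosed
    (modelWithCornersSelf ℝ (EuclideanSpace ℝ (Fin d))) hU.isClosed_compl hK
    (Set.disjoint_compl_left_iff_subset.2 hKU) (n := 1)
  have hsub : tsupport f ⊆ U := fun x hx => by
    by_contra hxU
    exact hx |> notMem_tsupport_iff_eventuallyEq.2 ((eventually_nhdsSet_iff_forall.1 h0) x hxU)
  exact ⟨f, f.contMDiff.contDiff, Metric.isCompact_of_isClosed_isBounded (isClosed_tsupport f)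
    (hb.subset hsub), hsub, eventually_nhdsSet_iff_forall.1 h1, hf⟩

theorem contDiff_smul_of_tsupport_subset {d : ℕ} {χ : EuclideanSpace ℝ (Fin d) → ℝ}
    {w : EuclideanSpace ℝ (Fin d) → EuclideanSpace ℝ (Fin d)} {V : Set (EuclideanSpace ℝ (Fin d))}
    (hV : IsOpen V) (hχ : ContDiff ℝ 1 χ) (hw : ContDiffOn ℝ 1 w V) (hs : tsupport χ ⊆ V) :
    ContDiff ℝ 1 fun x => χ x • w x := by
  rw [contDiff_iff_contDiffAt]
  intro x
  by_cases hx : x ∈ tsupport χ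
  · exact hχ.contDiffAt.smul (hw.contDiffAt (hV.mem_nhds (hs hx)))
  · refine (contDiffAt_const (c := (0 : EuclideanSpace ℝ (Fin d)))).congr_of_eventuallyEq ?_
    filter_upwards [notMem_tsupport_iff_eventuallyEq.1 hx] with y hy
    simp [hy]

theorem ofReal_setIntegral_divergence_le_perimeter {d : ℕ}
    {φ : EuclideanSpace ℝ (Fin d) → EuclideanSpace ℝ (Fin d)} (hφ : ContDiff ℝ 1 φ)
    (hc : HasCompactSupport φ) (h1 : ∀ x, ‖φ x‖ ≤ 1) (S : Set (EuclideanSpace ℝ (Fin d))) :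
    ENNReal.ofReal (∫ x in S, divergence φ x) ≤ perimeter S :=
  le_iSup_of_le φ <| le_iSup_of_le hφ <| le_iSup_of_le hc <| le_iSup_of_le h1 le_rfl

/-- A vector field `w` of length at most `1` and of constant divergence `h` on `A` calibrates the
perimeter from below; since `w` is shorter than `1` inside `A`, it may be perturbed there by a
multiple of any test field. -/
theorem exists_calibration_le_perimeter {d : ℕ} {A K V : Set (EuclideanSpace ℝ (Fin d))}
    {w ψ : EuclideanSpace ℝ (Fin d) → EuclideanSpace ℝ (Fin d)} {h : ℝ}
    (hK : IsCompact K) (hV : IsOpen V) (hAK : A ⊆ K) (hKV : K ⊆ V)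
    (hw : ContDiffOn ℝ 1 w V) (hle : ∀ x ∈ K, ‖w x‖ ≤ 1) (hlt : ∀ x ∈ A, ‖w x‖ < 1)
    (hdiv : ∀ x ∈ A, divergence w x = h)
    (hψ : ContDiff ℝ 1 ψ) (hψc : HasCompactSupport ψ) (hψA : tsupport ψ ⊆ A) :
    ∃ t > 0, ∀ S ⊆ A, MeasurableSet S → volume S ≠ ∞ →
      ENNReal.ofReal (h * volume.real S + t * ∫ x in S, divergence ψ x) ≤ perimeter S := by
  -- The support of `ψ` is compact inside `A`, so `|w|` stays away from `1` on it.
  obtain ⟨δ, hδ1, hδ⟩ : ∃ δ < 1, ∀ x ∈ tsupport ψ, ‖w x‖ ≤ δ := by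
    rcases (tsupport ψ).eq_empty_or_nonempty with he | hne
    · exact ⟨0, one_pos, by simp [he]⟩
    · obtain ⟨x, hx, hmax⟩ := IsCompact.exists_isMaxOn hψc hne
        (hw.continuousOn.norm.mono ((hψA.trans hAK).trans hKV))
      exact ⟨‖w x‖, hlt x (hψA hx), fun y hy => hmax hy⟩
  obtain ⟨M, hM⟩ := hψc.exists_bound_of_continuous hψ.continuous
  have hM0 : 0 ≤ M := (norm_nonneg _).trans (hM 0)
  refine ⟨(1 - δ) / (M + 1), div_pos (by linarith) (by linarith), fun S hSA hSm hSv => ?_⟩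
  set t := (1 - δ) / (M + 1) with ht
  have ht0 : 0 < t := div_pos (by linarith) (by linarith)
  have htψ (x) : t * ‖ψ x‖ ≤ 1 - δ := by
    calc t * ‖ψ x‖ ≤ t * (M + 1) := by gcongr; linarith [hM x]
      _ = 1 - δ := by rw [ht]; field_simp
  -- A cutoff of `w` must live on a neighbourhood of `K`, where `|w|` may exceed `1`. Where `|w| <
  -- s⁻¹`, the factor `s` restores admissibility; `s → 1` at the end.
  have key (s : ℝ) (hs0 : 0 < s) (hs1 : s < 1) :
      ENNReal.ofReal (s * (h * volume.real S) + t * ∫ x in S, divergence ψ x) ≤ perimeter S := by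
    obtain ⟨B, hB⟩ := hK.isBounded.subset_ball 0
    have hUo : IsOpen (V ∩ (fun x => ‖w x‖) ⁻¹' Set.Iio s⁻¹) :=
      hw.continuousOn.norm.isOpen_inter_preimage hV isOpen_Iio
    obtain ⟨χ, hχ, hχc, hχU, hχ1, hχb⟩ := exists_contDiff_cutoff hK.isClosed
      (hUo.inter (Metric.isOpen_ball (x := 0) (ε := B)))
      (Metric.isBounded_ball.subset Set.inter_subset_right)
      (fun x hx => ⟨⟨hKV hx, (hle x hx).trans_lt (one_lt_inv_iff₀.2 ⟨hs0, hs1⟩)⟩, hB hx⟩)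
    have hcw : ContDiff ℝ 1 fun x => χ x • w x :=
      contDiff_smul_of_tsupport_subset hV hχ hw fun x hx => (hχU hx).1.1
    have hφ : ContDiff ℝ 1 fun x => s • (χ x • w x) + t • ψ x :=
      (hcw.const_smul s).add (hψ.const_smul t)
    have hcwc : HasCompactSupport fun x => χ x • w x := hχc.smul_right
    have hφc : HasCompactSupport fun x => s • (χ x • w x) + t • ψ x :=
      (hcwc.smul_left (f := fun _ => s)).add (hψc.smul_left (f := fun _ => t))
    have hφ1 (x) : ‖s • (χ x • w x) + t • ψ x‖ ≤ 1 := by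
      refine (norm_add_le _ _).trans ?_
      rw [norm_smul, norm_smul, norm_smul, Real.norm_of_nonneg hs0.le, Real.norm_of_nonneg ht0.le,
        Real.norm_of_nonneg (hχb x).1]
      by_cases hx : x ∈ tsupport ψ
      · have h1 : s * (χ x * ‖w x‖) ≤ 1 * (1 * δ) := by
          have := hδ x hx
          have := (hχb x).1
          gcongr
          · exact (hχb x).2
        linarith [htψ x]
      · rw [image_eq_zero_of_notMem_tsupport hx, norm_zero, mul_zero, add_zero]
        by_cases hx' : x ∈ tsupport χ
        · have h2 : ‖w x‖ < s⁻¹ := (hχU hx').1.2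
          calc s * (χ x * ‖w x‖) ≤ s * (1 * s⁻¹) := by
                gcongr
                exact (hχb x).2
            _ = 1 := by field_simp
        · simp [image_eq_zero_of_notMem_tsupport hx']
    convert ofReal_setIntegral_divergence_le_perimeter hφ hφc hφ1 S using 2
    have hpt : ∀ x ∈ S, divergence (fun x => s • (χ x • w x) + t • ψ x) x =
        s * h + t * divergence ψ x := fun x hx => by
      have hd1 := hcw.differentiable one_ne_zero x
      have hd2 := hψ.differentiable one_ne_zero x
      have heq : (fun x => χ x • w x) =ᶠ[nhds x] w := by
        filter_upwards [hχ1 x (hAK (hSA hx))] with y hy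
        simp [hy]
      rw [divergence_add (hd1.fun_const_smul s) (hd2.fun_const_smul t), divergence_const_smul s hd1,
        divergence_const_smul t hd2, heq.divergence_eq, hdiv x (hSA hx)]
    have hconst : IntegrableOn (fun _ => s * h) S := integrableOn_const hSv
    rw [setIntegral_congr_fun hSm hpt, integral_add hconst
      ((integrable_divergence hψ hψc).integrableOn.const_mul t), setIntegral_const,
      integral_const_mul]
    simp only [smul_eq_mul]
    ring
  have hlim : Filter.Tendsto (fun s : ℝ => ENNReal.ofReal
      (s * (h * volume.real S) + t * ∫ x in S, divergence ψ x)) (nhdsWithin 1 (Set.Iio 1))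
      (nhds (ENNReal.ofReal (1 * (h * volume.real S) + t * ∫ x in S, divergence ψ x))) := by
    refine ((ENNReal.continuous_ofReal.comp ?_).tendsto 1).mono_left nhdsWithin_le_nhds
    fun_prop
  rw [one_mul] at hlim
  refine le_of_tendsto hlim ?_
  filter_upwards [Ioo_mem_nhdsLT one_pos] with s hs using key s hs.1 hs.2

/-! ### The calibrating field of the shell -/

/-- The radial field `(α + c |x|⁻ᵈ) x`, of divergence `d α` away from the origin. -/
noncomputable def radialField (d : ℕ) (α c : ℝ) (x : EuclideanSpace ℝ (Fin d)) :
    EuclideanSpace ℝ (Fin d) :=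
  (α + c * (‖x‖ ^ d)⁻¹) • x

theorem contDiffOn_radialField (d : ℕ) (α c : ℝ) :
    ContDiffOn ℝ 1 (radialField d α c) {0}ᶜ := by
  intro x hx
  have hx0 : x ≠ 0 := hx
  have hn : ContDiffAt ℝ 1 (fun x : EuclideanSpace ℝ (Fin d) => ‖x‖) x := contDiffAt_norm ℝ hx0
  exact ((contDiffAt_const.add (contDiffAt_const.mul ((hn.pow d).inv
    (pow_ne_zero _ (norm_ne_zero_iff.2 hx0))))).smul contDiffAt_id).contDiffWithinAt

theorem divergence_id {d : ℕ} (x : EuclideanSpace ℝ (Fin d)) : divergence (fun y => y) x = d := by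
  simp [divergence]

/-- The singular part `|x|⁻ᵈ x` is divergence-free off the origin, being proportional to the
gradient of the fundamental solution; only `α x` contributes. -/
theorem divergence_radialField {d : ℕ} (α c : ℝ) {x : EuclideanSpace ℝ (Fin d)} (hx : x ≠ 0) :
    divergence (radialField d α c) x = d * α := by
  have hx' : ‖x‖ ≠ 0 := norm_ne_zero_iff.2 hx
  have hn : DifferentiableAt ℝ (fun x : EuclideanSpace ℝ (Fin d) => ‖x‖) x :=
    (contDiffAt_norm ℝ hx (n := 1)).differentiableAt one_ne_zero
  have hg : HasDerivAt (fun y : ℝ => α + c * (y ^ d)⁻¹)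
      (c * (-(d * ‖x‖ ^ (d - 1)) / (‖x‖ ^ d) ^ 2)) ‖x‖ :=
    (((hasDerivAt_pow d ‖x‖).inv (pow_ne_zero _ hx')).const_mul c).const_add α
  have hη := hg.comp_hasFDerivAt x hn.hasFDerivAt
  have hη' : DifferentiableAt ℝ (fun y : EuclideanSpace ℝ (Fin d) => α + c * (‖y‖ ^ d)⁻¹) x :=
    hη.differentiableAt
  have hf : fderiv ℝ (fun y : EuclideanSpace ℝ (Fin d) => α + c * (‖y‖ ^ d)⁻¹) x x =
      c * (-(d * ‖x‖ ^ (d - 1)) / (‖x‖ ^ d) ^ 2) * ‖x‖ := by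
    have : fderiv ℝ (fun y : EuclideanSpace ℝ (Fin d) => α + c * (‖y‖ ^ d)⁻¹) x = _ := hη.fderiv
    rw [this, smul_apply, hn.fderiv_norm_self, smul_eq_mul]
  have := divergence_smul hη' (differentiableAt_fun_id (x := x))
  change divergence (fun y => (α + c * (‖y‖ ^ d)⁻¹) • y) x = _
  rw [this, hf, divergence_id]
  rcases d with _ | m
  · simp
  · simp only [add_tsub_cancel_right]
    field_simp
    ring

theorem norm_radialField {m : ℕ} (α c : ℝ) {x : EuclideanSpace ℝ (Fin (m + 1))} (hx : x ≠ 0) :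
    ‖radialField (m + 1) α c x‖ = |α * ‖x‖ + c * (‖x‖ ^ m)⁻¹| := by
  have hx' : ‖x‖ ≠ 0 := norm_ne_zero_iff.2 hx
  rw [radialField, norm_smul, Real.norm_eq_abs, ← abs_of_nonneg (norm_nonneg x), ← abs_mul,
    abs_of_nonneg (norm_nonneg x)]
  congr 1
  field_simp
  ring

/-- The slope of the radial field calibrating the shell: the Cheeger constant divided by `d`. -/
noncomputable def shellSlope (d : ℕ) (r R : ℝ) : ℝ :=
  (R ^ (d - 1) + r ^ (d - 1)) / (R ^ d - r ^ d)

/-- The singular coefficient of the radial field calibrating the shell. -/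
noncomputable def shellCoeff (d : ℕ) (r R : ℝ) : ℝ :=
  R ^ (d - 1) - shellSlope d r R * R ^ d

section Shell
variable {m : ℕ} {r R : ℝ}

theorem shellSlope_pos {d : ℕ} (hd : d ≠ 0) (hr : 0 < r) (hrR : r < R) : 0 < shellSlope d r R :=
  have := pow_lt_pow_left₀ hrR hr.le hd
  have hR := hr.trans hrR
  div_pos (by positivity) (by linarith)

/-- The slope is the value for which the boundary conditions at `R` and at `r` require the same
coefficient. -/
theorem shellCoeff_eq {d : ℕ} (hd : d ≠ 0) (hr : 0 < r) (hrR : r < R) :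
    shellCoeff d r R = -r ^ (d - 1) - shellSlope d r R * r ^ d := by
  have := pow_lt_pow_left₀ hrR hr.le hd
  have h : shellSlope d r R * (R ^ d - r ^ d) = R ^ (d - 1) + r ^ (d - 1) :=
    div_mul_cancel₀ _ (by linarith)
  rw [shellCoeff]
  linarith

/-- The slope is positive and the coefficient is not, so the linear term increases strictly and the
singular one weakly. -/
theorem strictMonoOn_shellProfile (hr : 0 < r) (hrR : r < R) :
    StrictMonoOn (fun y => shellSlope (m + 1) r R * y + shellCoeff (m + 1) r R * (y ^ m)⁻¹)
      (Set.Ioi 0) := by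
  intro a ha b _ hab
  have ha : 0 < a := ha
  have hα := shellSlope_pos (Nat.add_one_ne_zero m) hr hrR
  have hc : shellCoeff (m + 1) r R ≤ 0 := by
    rw [shellCoeff_eq (Nat.add_one_ne_zero m) hr hrR]
    have := mul_pos hα (pow_pos hr (m + 1))
    have := pow_pos hr (m + 1 - 1)
    linarith
  have h1 : (b ^ m)⁻¹ ≤ (a ^ m)⁻¹ := by gcongr
  exact add_lt_add_of_lt_of_le ((mul_lt_mul_iff_right₀ hα).2 hab)
    (mul_le_mul_of_nonpos_left h1 hc)

theorem shellProfile_outer (hr : 0 < r) (hrR : r < R) :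
    shellSlope (m + 1) r R * R + shellCoeff (m + 1) r R * (R ^ m)⁻¹ = 1 := by
  have hR := hr.trans hrR
  rw [shellCoeff, add_tsub_cancel_right]
  field_simp
  ring

theorem shellProfile_inner (hr : 0 < r) (hrR : r < R) :
    shellSlope (m + 1) r R * r + shellCoeff (m + 1) r R * (r ^ m)⁻¹ = -1 := by
  rw [shellCoeff_eq (Nat.add_one_ne_zero m) hr hrR, add_tsub_cancel_right]
  field_simp
  ring

theorem norm_shellField_le_one (hr : 0 < r) (hrR : r < R) {x : EuclideanSpace ℝ (Fin (m + 1))}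
    (h1 : r ≤ ‖x‖) (h2 : ‖x‖ ≤ R) :
    ‖radialField (m + 1) (shellSlope (m + 1) r R) (shellCoeff (m + 1) r R) x‖ ≤ 1 := by
  have hx := hr.trans_le h1
  have hm := (strictMonoOn_shellProfile (m := m) hr hrR).monotoneOn
  rw [norm_radialField _ _ (norm_pos_iff.1 hx), abs_le]
  exact ⟨(shellProfile_inner hr hrR).symm.trans_le (hm hr hx h1),
    (hm hx (hr.trans hrR) h2).trans_eq (shellProfile_outer hr hrR)⟩

theorem norm_shellField_lt_one (hr : 0 < r) (hrR : r < R) {x : EuclideanSpace ℝ (Fin (m + 1))}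
    (h1 : r < ‖x‖) (h2 : ‖x‖ < R) :
    ‖radialField (m + 1) (shellSlope (m + 1) r R) (shellCoeff (m + 1) r R) x‖ < 1 := by
  have hx := hr.trans h1
  have hm := strictMonoOn_shellProfile (m := m) hr hrR
  rw [norm_radialField _ _ (norm_pos_iff.1 hx), abs_lt]
  exact ⟨(shellProfile_inner hr hrR).symm.trans_lt (hm hr hx h1),
    (hm hx (hr.trans hrR) h2).trans_eq (shellProfile_outer hr hrR)⟩

end Shell

theorem exists_shell_le_perimeter {d : ℕ} (hd : d ≠ 0) {r R : ℝ} (hr : 0 < r) (hrR : r < R)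
    {ψ : EuclideanSpace ℝ (Fin d) → EuclideanSpace ℝ (Fin d)}
    (hψ : ContDiff ℝ 1 ψ) (hψc : HasCompactSupport ψ) (hψA : tsupport ψ ⊆ sphericalShell d r R) :
    ∃ t > 0, ∀ S ⊆ sphericalShell d r R, MeasurableSet S → volume S ≠ ∞ →
      ENNReal.ofReal (d * shellSlope d r R * volume.real S + t * ∫ x in S, divergence ψ x) ≤
        perimeter S := by
  obtain ⟨m, rfl⟩ := Nat.exists_eq_succ_of_ne_zero hd
  refine exists_calibration_le_perimeter (K := {x | r ≤ ‖x‖ ∧ ‖x‖ ≤ R}) (V := {0}ᶜ)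
    (w := radialField (m + 1) (shellSlope (m + 1) r R) (shellCoeff (m + 1) r R))
    ?_ isOpen_compl_singleton (fun x hx => ⟨hx.1.le, hx.2.le⟩) (fun x hx => ?_)
    (contDiffOn_radialField _ _ _) (fun x hx => norm_shellField_le_one hr hrR hx.1 hx.2)
    (fun x hx => norm_shellField_lt_one hr hrR hx.1 hx.2)
    (fun x hx => divergence_radialField _ _ (norm_pos_iff.1 (hr.trans hx.1))) hψ hψc hψA
  · refine (isCompact_closedBall (0 : EuclideanSpace ℝ (Fin (m + 1))) R).of_isClosed_subset
      ((isClosed_le continuous_const continuous_norm).inter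
        (isClosed_le continuous_norm continuous_const)) fun x hx => ?_
    simpa using hx.2
  · exact norm_pos_iff.1 (hr.trans_le hx.1)

/-! ### Sets with vanishing distributional gradient -/

theorem divergence_smul_const {d : ℕ} {η : EuclideanSpace ℝ (Fin d) → ℝ}
    {x : EuclideanSpace ℝ (Fin d)} (hη : DifferentiableAt ℝ η x) (v : EuclideanSpace ℝ (Fin d)) :
    divergence (fun y => η y • v) x = fderiv ℝ η x v := by
  rw [divergence_smul hη (differentiableAt_const v)]
  simp [divergence]

/-- The derivative of the mollified indicator at `x` along `v` is minus the integral over `S` of the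
divergence of `t ↦ ρ (x - t) • v`, a test field supported in the closed `ε`-ball about `x`. -/
theorem fderiv_convolution_indicator_eq_zero {d : ℕ} {A S : Set (EuclideanSpace ℝ (Fin d))}
    (hSm : MeasurableSet S) (hSv : volume S ≠ ∞)
    (H : ∀ ψ : EuclideanSpace ℝ (Fin d) → EuclideanSpace ℝ (Fin d), ContDiff ℝ 1 ψ →
      HasCompactSupport ψ → tsupport ψ ⊆ A → ∫ x in S, divergence ψ x = 0)
    {ρ : EuclideanSpace ℝ (Fin d) → ℝ} (hρ : ContDiff ℝ 1 ρ) {ε : ℝ}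
    (hρε : tsupport ρ ⊆ Metric.closedBall 0 ε) {x : EuclideanSpace ℝ (Fin d)}
    (hx : Metric.closedBall x ε ⊆ A) :
    HasFDerivAt (𝕜 := ℝ)
      (convolution (S.indicator fun _ => (1 : ℝ)) ρ (ContinuousLinearMap.lsmul ℝ ℝ) volume)
      (0 : EuclideanSpace ℝ (Fin d) →L[ℝ] ℝ) x := by
  have hρc : HasCompactSupport ρ :=
    (isCompact_closedBall 0 ε).of_isClosed_subset (isClosed_tsupport ρ) hρε
  have hu : LocallyIntegrable (S.indicator fun _ => (1 : ℝ)) (volume : Measure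
      (EuclideanSpace ℝ (Fin d))) :=
    ((integrable_indicator_iff hSm).2 (integrableOn_const hSv)).locallyIntegrable
  have hd := hρc.hasFDerivAt_convolution_right (ContinuousLinearMap.lsmul ℝ ℝ) hu hρ x
  refine hd.congr_fderiv (ContinuousLinearMap.ext fun v => ?_)
  rw [convolution_precompR_apply _ hu (hρc.fderiv ℝ) (hρ.continuous_fderiv one_ne_zero)]
  have hη : ContDiff ℝ 1 fun t => ρ (x - t) := hρ.comp (contDiff_const.sub contDiff_id)
  have hsupp : tsupport (fun t => ρ (x - t) • v) ⊆ Metric.closedBall x ε := by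
    refine closure_minimal (fun t ht => ?_) Metric.isClosed_closedBall
    have : x - t ∈ tsupport ρ := subset_tsupport ρ fun h0 => ht (by simp [h0])
    have := hρε this
    rwa [mem_closedBall_zero_iff, ← dist_eq_norm, dist_comm] at this
  have h0 := H (fun t => ρ (x - t) • v) (hη.smul contDiff_const)
    ((isCompact_closedBall x ε).of_isClosed_subset (isClosed_tsupport _) hsupp) (hsupp.trans hx)
  have hdiv (t) : divergence (fun t => ρ (x - t) • v) t = -fderiv ℝ ρ (x - t) v := by
    rw [divergence_smul_const (hη.differentiable one_ne_zero t)]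
    have := (hρ.differentiable one_ne_zero (x - t)).hasFDerivAt.comp t
      ((hasFDerivAt_id t).const_sub x)
    have h' : fderiv ℝ (fun t => ρ (x - t)) t = _ := this.fderiv
    rw [h']
    simp
  simp_rw [hdiv, integral_neg, neg_eq_zero] at h0
  rw [convolution_def, zero_apply, ← h0, ← integral_indicator hSm]
  refine integral_congr_ae (Filter.Eventually.of_forall fun t => ?_)
  by_cases ht : t ∈ S <;> simp [ht]

/-- A set whose indicator has zero distributional gradient in a ball is null or conull near its
centre. -/
theorem ae_mem_or_ae_notMem_ball {d : ℕ} {A S : Set (EuclideanSpace ℝ (Fin d))}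
    (hSm : MeasurableSet S) (hSv : volume S ≠ ∞)
    (H : ∀ ψ : EuclideanSpace ℝ (Fin d) → EuclideanSpace ℝ (Fin d), ContDiff ℝ 1 ψ →
      HasCompactSupport ψ → tsupport ψ ⊆ A → ∫ x in S, divergence ψ x = 0)
    {x : EuclideanSpace ℝ (Fin d)} {δ : ℝ} (hδ : 0 < δ) (hx : Metric.ball x (2 * δ) ⊆ A) :
    (∀ᵐ y, y ∈ Metric.ball x δ → y ∈ S) ∨ ∀ᵐ y, y ∈ Metric.ball x δ → y ∉ S := by
  have hpos (n : ℕ) : 0 < δ / (n + 1) := by positivity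
  -- Radii in the fixed ratio `2`, as needed for almost everywhere convergence; kernel widths at
  -- most `δ` keep test fields centred in the `δ`-ball inside the `2 * δ`-ball.
  let b (n : ℕ) : ContDiffBump (0 : EuclideanSpace ℝ (Fin d)) :=
    ⟨δ / (n + 1) / 2, δ / (n + 1), half_pos (hpos n), half_lt_self (hpos n)⟩
  set u : EuclideanSpace ℝ (Fin d) → ℝ := S.indicator fun _ => (1 : ℝ) with hu_def
  have hu : LocallyIntegrable u volume :=
    ((integrable_indicator_iff hSm).2 (integrableOn_const hSv)).locallyIntegrable
  have hlim := ContDiffBump.ae_convolution_tendsto_right_of_locallyIntegrable (μ := volume)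
    (φ := b) (l := Filter.atTop) (K := 2) (g := u)
    (by simpa [b, div_eq_mul_inv] using
      (tendsto_one_div_add_atTop_nhds_zero_nat (𝕜 := ℝ)).const_mul δ)
    (Filter.Eventually.of_forall fun n => by simp only [b]; linarith) hu
  have hconst (n : ℕ) {y z : EuclideanSpace ℝ (Fin d)} (hy : y ∈ Metric.ball x δ)
      (hz : z ∈ Metric.ball x δ) :
      convolution ((b n).normed volume) u (ContinuousLinearMap.lsmul ℝ ℝ) volume y =
      convolution ((b n).normed volume) u (ContinuousLinearMap.lsmul ℝ ℝ) volume z := by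
    have hswap : convolution ((b n).normed volume) u (ContinuousLinearMap.lsmul ℝ ℝ) volume =
        convolution u ((b n).normed volume) (ContinuousLinearMap.lsmul ℝ ℝ) volume := by
      ext y
      rw [convolution_eq_swap, convolution_def]
      simp [mul_comm]
    have hder (y) (hy : y ∈ Metric.ball x δ) : HasFDerivAt (𝕜 := ℝ)
        (convolution u ((b n).normed volume) (ContinuousLinearMap.lsmul ℝ ℝ) volume)
        (0 : EuclideanSpace ℝ (Fin d) →L[ℝ] ℝ) y := by
      refine fderiv_convolution_indicator_eq_zero hSm hSv H (b n).contDiff_normed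
        ((b n).tsupport_normed_eq (μ := volume)).subset fun z hz => hx ?_
      have h1 : dist z y ≤ δ / (n + 1) := hz
      have h2 : δ / (n + 1) ≤ δ := div_le_self hδ.le (by linarith [n.cast_nonneg (α := ℝ)])
      have h3 : dist y x < δ := hy
      rw [Metric.mem_ball]
      linarith [dist_triangle z y x]
    rw [hswap]
    exact Metric.isOpen_ball.is_const_of_fderiv_eq_zero (𝕜 := ℝ)
      (convex_ball x δ).isPreconnected
      (fun y hy => (hder y hy).differentiableAt.differentiableWithinAt)
      (fun y hy => (hder y hy).fderiv) hy hz
  -- The ball has positive measure, so the mollifications converge at some point of it; being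
  -- constant on the ball, they have the same limit almost everywhere there.
  obtain ⟨y, hy, hylim⟩ : ∃ y ∈ Metric.ball x δ, Filter.Tendsto (fun n => convolution
      ((b n).normed volume) u (ContinuousLinearMap.lsmul ℝ ℝ) volume y) Filter.atTop
      (nhds (u y)) := by
    by_contra! hcon
    refine (Metric.measure_ball_pos volume x hδ).ne' (measure_mono_null (fun y hy => ?_)
      (ae_iff.1 hlim))
    exact hcon y hy
  have heq : ∀ᵐ z, z ∈ Metric.ball x δ → u z = u y := by
    filter_upwards [hlim] with z hz hzb
    refine tendsto_nhds_unique hz (hylim.congr fun n => hconst n hy hzb)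
  by_cases hyS : y ∈ S
  · left
    filter_upwards [heq] with z hz hzb
    by_contra hzS
    simpa [hu_def, hyS, hzS] using hz hzb
  · right
    filter_upwards [heq] with z hz hzb hzS
    simpa [hu_def, hyS, hzS] using hz hzb

/-- A set of positive measure without perimeter inside a connected open set fills it. -/
theorem ae_eq_of_integral_divergence_eq_zero {d : ℕ} {A S : Set (EuclideanSpace ℝ (Fin d))}
    (hA : IsOpen A) (hAc : IsPreconnected A) (hSA : S ⊆ A)
    (hSm : MeasurableSet S) (hSv : volume S ≠ ∞) (hS0 : 0 < volume S)
    (H : ∀ ψ : EuclideanSpace ℝ (Fin d) → EuclideanSpace ℝ (Fin d), ContDiff ℝ 1 ψ →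
      HasCompactSupport ψ → tsupport ψ ⊆ A → ∫ x in S, divergence ψ x = 0) :
    S =ᵐ[volume] A := by
  -- The points near which `T` is conull. `U S` and `U Sᶜ` are open, disjoint on `A`, and cover it,
  -- so connectedness selects one.
  let U (T : Set (EuclideanSpace ℝ (Fin d))) : Set (EuclideanSpace ℝ (Fin d)) :=
    {x | ∃ V, IsOpen V ∧ x ∈ V ∧ volume (V \ T) = 0}
  have hU (T) : IsOpen (U T) := isOpen_iff_forall_mem_open.2 fun x ⟨V, hV, hxV, h0⟩ =>
    ⟨V, fun y hy => ⟨V, hV, hy, h0⟩, hV, hxV⟩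
  have hdis : A ∩ (U S ∩ U Sᶜ) = ∅ := by
    refine Set.eq_empty_of_forall_notMem fun x ⟨_, ⟨V, hV, hxV, hV0⟩, ⟨W, hW, hxW, hW0⟩⟩ => ?_
    refine ((hV.inter hW).measure_pos volume ⟨x, hxV, hxW⟩).ne'
      (measure_mono_null (fun y hy => ?_) (measure_union_null hV0 hW0))
    by_cases hyS : y ∈ S
    · exact Or.inr ⟨hy.2, fun h => h hyS⟩
    · exact Or.inl ⟨hy.1, hyS⟩
  have hcov : A ⊆ U S ∪ U Sᶜ := fun x hx => by
    obtain ⟨ε, hε, hball⟩ := Metric.isOpen_iff.1 hA x hx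
    have hδ : 0 < ε / 2 := half_pos hε
    rw [← mul_div_cancel₀ ε two_ne_zero] at hball
    refine (ae_mem_or_ae_notMem_ball hSm hSv H hδ hball).imp
      (fun h => ⟨Metric.ball x (ε / 2), Metric.isOpen_ball, Metric.mem_ball_self hδ, ?_⟩)
      (fun h => ⟨Metric.ball x (ε / 2), Metric.isOpen_ball, Metric.mem_ball_self hδ, ?_⟩)
    · refine measure_mono_null (fun y hy => ?_) (ae_iff.1 h)
      exact fun h' => hy.2 (h' hy.1)
    · refine measure_mono_null (fun y hy => ?_) (ae_iff.1 h)
      exact fun h' => hy.2 (h' hy.1)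
  have hnull (T) (h : A ⊆ U T) : volume (A \ T) = 0 := by
    refine measure_null_of_locally_null _ fun x hx => ?_
    obtain ⟨V, hV, hxV, hV0⟩ := h hx.1
    refine ⟨V \ T, mem_nhdsWithin.2 ⟨V, hV, hxV, fun y hy => ⟨hy.1, hy.2.2⟩⟩, hV0⟩
  rcases isPreconnected_iff_subset_of_disjoint.1 hAc _ _ (hU S) (hU Sᶜ) hcov hdis with h | h
  · exact hSA.eventuallyLE.antisymm (ae_le_set.2 (hnull S h))
  · refine absurd (hnull _ h) ?_
    rw [Set.sdiff_compl, Set.inter_eq_right.2 hSA]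
    exact hS0.ne'

/-! ### The shell: connectedness, volume, perimeter, Cheeger constant -/

theorem isOpen_sphericalShell (d : ℕ) (r R : ℝ) : IsOpen (sphericalShell d r R) :=
  (isOpen_lt continuous_const continuous_norm).inter (isOpen_lt continuous_norm continuous_const)

/-- In polar coordinates the shell is the image of an interval times the unit sphere, and the sphere
is connected because `d ≥ 2`. -/
theorem isPreconnected_sphericalShell {d : ℕ} (hd : 2 ≤ d) {r R : ℝ} (hr : 0 < r) :
    IsPreconnected (sphericalShell d r R) := by
  have hrank : 1 < Module.rank ℝ (EuclideanSpace ℝ (Fin d)) := by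
    rw [← Module.finrank_eq_rank, finrank_euclideanSpace_fin]
    exact_mod_cast hd
  have himage : sphericalShell d r R = (fun p : ℝ × EuclideanSpace ℝ (Fin d) => p.1 • p.2) ''
      (Set.Ioo r R ×ˢ Metric.sphere 0 1) := by
    ext x
    constructor
    · intro hx
      have hx0 : ‖x‖ ≠ 0 := (hr.trans hx.1).ne'
      refine ⟨(‖x‖, ‖x‖⁻¹ • x), ⟨hx, ?_⟩, ?_⟩
      · simp [norm_smul, hx0]
      · simp [smul_smul, hx0]
    · rintro ⟨⟨t, y⟩, ⟨ht, hy⟩, rfl⟩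
      have hy1 : ‖y‖ = 1 := by simpa using hy
      have ht0 : 0 < t := hr.trans ht.1
      simpa [sphericalShell, norm_smul, hy1, abs_of_pos ht0] using ht
  rw [himage]
  exact (isPreconnected_Ioo.prod (isPreconnected_sphere hrank 0 1)).image _
    (continuous_fst.smul continuous_snd).continuousOn

theorem sphericalShell_eq_sdiff (d : ℕ) (r R : ℝ) :
    sphericalShell d r R = Metric.ball 0 R \ Metric.closedBall 0 r := by
  ext x
  simp [sphericalShell, and_comm]

theorem volume_real_sphericalShell {d : ℕ} [NeZero d] {r R : ℝ} (hr : 0 < r) (hrR : r < R) :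
    volume.real (sphericalShell d r R) =
      volume.real (Metric.ball (0 : EuclideanSpace ℝ (Fin d)) 1) * (R ^ d - r ^ d) := by
  have hR := hr.trans hrR
  rw [sphericalShell_eq_sdiff, measureReal_sdiff (Metric.closedBall_subset_ball hrR)
    measurableSet_closedBall measure_ball_lt_top.ne, measureReal_def, measureReal_def,
    measureReal_def, Measure.addHaar_ball_of_pos _ _ hR, Measure.addHaar_closedBall _ _ hr.le,
    ENNReal.toReal_mul, ENNReal.toReal_mul, finrank_euclideanSpace_fin,
    ENNReal.toReal_ofReal (by positivity), ENNReal.toReal_ofReal (by positivity)]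
  ring

/-- The integral over the shell is a difference of two ball integrals; the flux bound is applied to
`φ` on the outer ball and to `-φ` on the inner one. -/
theorem perimeter_sphericalShell_le {d : ℕ} [NeZero d] {r R : ℝ} (hr : 0 < r) (hrR : r < R) :
    perimeter (sphericalShell d r R) ≤
      ENNReal.ofReal (d * shellSlope d r R * volume.real (sphericalShell d r R)) := by
  have hR := hr.trans hrR
  refine iSup_le fun φ => iSup_le fun hφ => iSup_le fun hc => iSup_le fun h1 =>
    ENNReal.ofReal_le_ofReal ?_
  have hpow := pow_lt_pow_left₀ hrR hr.le (NeZero.ne d)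
  have hslope : shellSlope d r R * (R ^ d - r ^ d) = R ^ (d - 1) + r ^ (d - 1) :=
    div_mul_cancel₀ _ (by linarith)
  have hint := integrable_divergence hφ hc
  have hball : Metric.closedBall (0 : EuclideanSpace ℝ (Fin d)) r =ᵐ[volume] Metric.ball 0 r :=
    (ae_le_set.2 (by rw [Metric.closedBall_sdiff_ball,
      Measure.addHaar_sphere_of_ne_zero volume 0 hr.ne'])).antisymm
      Metric.ball_subset_closedBall.eventuallyLE
  have houter := integral_ball_divergence_le hR.le hφ hc h1
  have hinner := integral_ball_divergence_le hr.le hφ.neg hc.neg (by simpa using h1)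
  simp_rw [divergence_neg, integral_neg] at hinner
  rw [sphericalShell_eq_sdiff, setIntegral_sdiff measurableSet_closedBall hint.integrableOn
    (Metric.closedBall_subset_ball hrR), ← sphericalShell_eq_sdiff,
    volume_real_sphericalShell hr hrR,
    setIntegral_congr_set hball]
  calc _ ≤ d * volume.real (Metric.ball (0 : EuclideanSpace ℝ (Fin d)) 1) *
          (shellSlope d r R * (R ^ d - r ^ d)) := by rw [hslope]; linarith
    _ = _ := by ring

theorem shellSlope_mul_volume_le_perimeter {d : ℕ} (hd : d ≠ 0) {r R : ℝ} (hr : 0 < r) (hrR : r < R)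
    {S : Set (EuclideanSpace ℝ (Fin d))} (hSA : S ⊆ sphericalShell d r R) (hSm : MeasurableSet S)
    (hSv : volume S ≠ ∞) : ENNReal.ofReal (d * shellSlope d r R) * volume S ≤ perimeter S := by
  -- The plain calibration bound is the unperturbed case `ψ = 0`.
  obtain ⟨t, -, ht⟩ := exists_shell_le_perimeter hd hr hrR
    (ψ := fun _ => 0) contDiff_const HasCompactSupport.zero (by simp [tsupport, Function.support])
  have := ht S hSA hSm hSv
  have hα := shellSlope_pos hd hr hrR
  rw [← ENNReal.ofReal_toReal hSv, ← ENNReal.ofReal_mul (by positivity)]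
  simpa [divergence, measureReal_def] using this

theorem isCheegerCompetitor_sphericalShell {d : ℕ} [NeZero d] {r R : ℝ} (hr : 0 < r)
    (hrR : r < R) : IsCheegerCompetitor (sphericalShell d r R) (sphericalShell d r R) where
  subset := subset_rfl
  measurableSet := (isOpen_sphericalShell d r R).measurableSet
  isBounded := Metric.isBounded_ball.subset
    ((sphericalShell_eq_sdiff d r R).trans_subset Set.sdiff_subset)
  volume_pos := by
    have hpow := pow_lt_pow_left₀ hrR hr.le (NeZero.ne d)
    have hball : 0 < volume.real (Metric.ball (0 : EuclideanSpace ℝ (Fin d)) 1) :=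
      ENNReal.toReal_pos (Metric.measure_ball_pos volume _ one_pos).ne' measure_ball_lt_top.ne
    refine pos_of_ne_zero fun h0 => ?_
    have h1 := volume_real_sphericalShell (d := d) hr hrR
    rw [measureReal_def, h0, ENNReal.toReal_zero] at h1
    exact (mul_pos hball (sub_pos.2 hpow)).ne h1

theorem perimeter_div_volume_sphericalShell_le {d : ℕ} [NeZero d] {r R : ℝ} (hr : 0 < r)
    (hrR : r < R) : perimeter (sphericalShell d r R) / volume (sphericalShell d r R) ≤
      ENNReal.ofReal (d * shellSlope d r R) := by
  have hα := shellSlope_pos (NeZero.ne d) hr hrR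
  have hA := isCheegerCompetitor_sphericalShell (d := d) hr hrR
  refine ENNReal.div_le_of_le_mul ((perimeter_sphericalShell_le hr hrR).trans_eq ?_)
  rw [ENNReal.ofReal_mul (by positivity), measureReal_def,
    ENNReal.ofReal_toReal hA.isBounded.measure_lt_top.ne]

theorem le_perimeter_div_volume_of_isCheegerCompetitor {d : ℕ} (hd : d ≠ 0) {r R : ℝ} (hr : 0 < r)
    (hrR : r < R) {S : Set (EuclideanSpace ℝ (Fin d))}
    (hS : IsCheegerCompetitor (sphericalShell d r R) S) :
    ENNReal.ofReal (d * shellSlope d r R) ≤ perimeter S / volume S :=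
  (ENNReal.le_div_iff_mul_le (.inl hS.volume_pos.ne') (.inl hS.isBounded.measure_lt_top.ne)).2
    (shellSlope_mul_volume_le_perimeter hd hr hrR hS.subset hS.measurableSet
      hS.isBounded.measure_lt_top.ne)

theorem cheegerConstant_sphericalShell {d : ℕ} [NeZero d] {r R : ℝ} (hr : 0 < r) (hrR : r < R) :
    cheegerConstant (sphericalShell d r R) = ENNReal.ofReal (d * shellSlope d r R) :=
  le_antisymm
    (iInf₂_le_of_le _ (isCheegerCompetitor_sphericalShell hr hrR)
      (perimeter_div_volume_sphericalShell_le hr hrR))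
    (le_iInf₂ fun _ hS => le_perimeter_div_volume_of_isCheegerCompetitor (NeZero.ne d) hr hrR hS)

/-! ### Uniqueness and conclusion -/

/-- Equality in the unperturbed bound forces the term `t * ∫_S div ψ` to be nonpositive, for `ψ` and
for `-ψ`. -/
theorem integral_divergence_eq_zero_of_isCheegerSet {d : ℕ} [NeZero d] {r R : ℝ} (hr : 0 < r)
    (hrR : r < R) {S : Set (EuclideanSpace ℝ (Fin d))}
    (hS : IsCheegerSet (sphericalShell d r R) S)
    {ψ : EuclideanSpace ℝ (Fin d) → EuclideanSpace ℝ (Fin d)} (hψ : ContDiff ℝ 1 ψ)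
    (hψc : HasCompactSupport ψ) (hψA : tsupport ψ ⊆ sphericalShell d r R) :
    ∫ x in S, divergence ψ x = 0 := by
  have hα := shellSlope_pos (NeZero.ne d) hr hrR
  have hSv : volume S ≠ ∞ := hS.1.isBounded.measure_lt_top.ne
  have hP : perimeter S = ENNReal.ofReal (d * shellSlope d r R * volume.real S) := by
    have := hS.2
    rw [cheegerConstant_sphericalShell hr hrR] at this
    rw [ENNReal.ofReal_mul (by positivity), measureReal_def, ENNReal.ofReal_toReal hSv, ← this,
      ENNReal.div_mul_cancel hS.1.volume_pos.ne' hSv]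
  have key {ψ : EuclideanSpace ℝ (Fin d) → EuclideanSpace ℝ (Fin d)} (hψ : ContDiff ℝ 1 ψ)
      (hψc : HasCompactSupport ψ) (hψA : tsupport ψ ⊆ sphericalShell d r R) :
      ∫ x in S, divergence ψ x ≤ 0 := by
    obtain ⟨t, ht0, ht⟩ := exists_shell_le_perimeter (NeZero.ne d) hr hrR hψ hψc hψA
    have := ht S hS.1.subset hS.1.measurableSet hSv
    rw [hP, ENNReal.ofReal_le_ofReal_iff (by positivity)] at this
    exact nonpos_of_mul_nonpos_right (by linarith) ht0
  refine (key hψ hψc hψA).antisymm ?_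
  have hneg := key (ψ := fun x => -ψ x) hψ.neg hψc.neg
    (by rwa [show (fun x => -ψ x) = -ψ from rfl, tsupport, Function.support_neg])
  simp_rw [divergence_neg, integral_neg] at hneg
  linarith

theorem theorem2 (d : ℕ) (hd : 2 ≤ d) (r R : ℝ) (hr : 0 < r) (hrR : r < R) :
    IsMinimalCheegerSet (sphericalShell d r R) ∧
    cheegerConstant (sphericalShell d r R) =
      ENNReal.ofReal ((d : ℝ) * ((R ^ (d - 1) + r ^ (d - 1)) / (R ^ d - r ^ d))) := by
  have : NeZero d := ⟨by omega⟩
  have hconst := cheegerConstant_sphericalShell (d := d) hr hrR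
  have hA := isCheegerCompetitor_sphericalShell (d := d) hr hrR
  refine ⟨⟨⟨hA, ?_⟩, fun S hS => ?_⟩, hconst⟩
  · rw [hconst]
    exact (perimeter_div_volume_sphericalShell_le hr hrR).antisymm
      (le_perimeter_div_volume_of_isCheegerCompetitor (NeZero.ne d) hr hrR hA)
  · exact ae_eq_of_integral_divergence_eq_zero (isOpen_sphericalShell d r R)
      (isPreconnected_sphericalShell hd hr) hS.1.subset hS.1.measurableSet
      hS.1.isBounded.measure_lt_top.ne hS.1.volume_pos
      fun ψ hψ hψc hψA => integral_divergence_eq_zero_of_isCheegerSet hr hrR hS hψ hψc hψA
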